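/- Let $\mathcal H$ be a complex Hilbert space of dimension $n$, let $\psi_1,\dots,\psi_n\in\mathcal H$ be linearly independent unit vectors and let $p_1,\dots,p_n>0$ with $\sum_i p_i=1$. Put $\tilde\psi_i=\sqrt{p_i}\,\psi_i$, let $G$ be the Gram matrix $G_{ij}=\langle\tilde\psi_i,\tilde\psi_j\rangle$ (inner products are linear in the second argument), and let $\tilde u_1,\dots,\tilde u_n$ be the dual vectors, determined by $\langle\tilde\psi_i,\tilde u_j\rangle=\delta_{ij}$. An $n$-POVM is a family $E=(E_i)_{i=1}^n$ of positive semidefinite operators on $\mathcal H$ with $\sum_i E_i=\mathbb 1$; it is optimal for minimum-error discrimination of the ensemble $\{p_i,|\psi_i\rangle\langle\psi_i|\}_{i=1}^n$ if it maximizes the success probability $\sum_i p_i\langle\psi_i,E_i\psi_i\rangle$ among all $n$-POVMs. For a positive definite Hermitian $n\times n$ matrix $X$ let $D_X$ be the diagonal matrix with entries $\sqrt{X_{ii}}$. Call $X$ a positive definite solution if $$X^2=D_X\,G\,D_X ,$$ and put $w_i^X=\sum_{j=1}^n (D_X^{-1}X)_{ji}\,\tilde u_j$. Then: 1. If $X$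 is a positive definite solution, then $(w_i^X)_{i=1}^n$ is an orthonormal basis of $\mathcal H$, and $(|w_i^X\rangle\langle w_i^X|)_{i=1}^n$ is an optimal POVM and the only one. 2. There is at most one positive definite solution $X$. 3. An $n$-POVM $E$ is optimal if and only if there is a positive definite solution $X$ with $E_i=|w_i^X\rangle\langle w_i^X|$ for all $i$. (The equation for $X$ involves the ensemble only through $G$, hence is invariant under unitary transformations of the states.) -/

import Mathlib

open scoped ComplexOrder InnerProductSpace

namespace MED

noncomputable section

variable {n : ℕ} {H : Type*} [NormedAddCommGroup H] [InnerProductSpace ℂ H]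

/-- An `n`-element POVM on `H`: positive operators that sum to the identity. -/
structure IsPOVM (E : Fin n → H →L[ℂ] H) : Prop where
  isPositive : ∀ i, (E i).IsPositive
  sum_eq_one : ∑ i, E i = 1

/-- Average probability of success `∑ i, p i ⟨ψ i| E i |ψ i⟩`. -/
def successProb (p : Fin n → ℝ) (ψ : Fin n → H) (E : Fin n → H →L[ℂ] H) : ℝ :=
  ∑ i, p i * (⟪ψ i, E i (ψ i)⟫_ℂ).re

/-- `E` is an optimal POVM for minimum-error discrimination of `{p i, |ψ i⟩⟨ψ i|}`: it maximizes
the success probability (equivalently, minimizes the error probability) among all `n`-POVMs. -/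
def IsOptimalPOVM (p : Fin n → ℝ) (ψ : Fin n → H) (E : Fin n → H →L[ℂ] H) : Prop :=
  IsPOVM E ∧ ∀ F : Fin n → H →L[ℂ] H, IsPOVM F → successProb p ψ F ≤ successProb p ψ E

/-- The subnormalized states `√(p i) |ψ i⟩`. -/
def scaledState (p : Fin n → ℝ) (ψ : Fin n → H) (i : Fin n) : H :=
  ((√(p i) : ℝ) : ℂ) • ψ i

/-- The Gram matrix `G i j = √(p i * p j) ⟨ψ i|ψ j⟩` of the ensemble. -/
def gramMatrix (p : Fin n → ℝ) (ψ : Fin n → H) : Matrix (Fin n) (Fin n) ℂ :=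
  Matrix.gram ℂ (scaledState p ψ)

/-- The vectors dual to the subnormalized states, `u k = ∑ j, (G⁻¹) j k • √(p j) |ψ j⟩`;
see `inner_scaledState_dualState`. -/
def dualState (p : Fin n → ℝ) (ψ : Fin n → H) (k : Fin n) : H :=
  ∑ j, (gramMatrix p ψ)⁻¹ j k • scaledState p ψ j

/-- The nonnegative real diagonal matrix `D` whose square is the diagonal of `X`
(for `X` with nonnegative real diagonal). -/
def sqrtDiag (X : Matrix (Fin n) (Fin n) ℂ) : Matrix (Fin n) (Fin n) ℂ :=
  Matrix.diagonal fun i => ((√(X i i).re : ℝ) : ℂ)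

/-- `X` is a positive definite (Hermitian) solution of `X² = D G D`, where `D ≥ 0` is the diagonal
matrix such that `D²` is the diagonal of `X`. -/
structure IsPosDefSolution (G X : Matrix (Fin n) (Fin n) ℂ) : Prop where
  posDef : X.PosDef
  sq_eq : X ^ 2 = sqrtDiag X * G * sqrtDiag X

/-- The vectors `w i = ∑ j, (D⁻¹ X) j i • u j` that correspond to `X`. -/
def basisOf (p : Fin n → ℝ) (ψ : Fin n → H) (X : Matrix (Fin n) (Fin n) ℂ) (i : Fin n) : H :=
  ∑ j, ((sqrtDiag X)⁻¹ * X) j i • dualState p ψ j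

/-- The family `|w i⟩⟨w i|`. -/
def rankOneFamily (w : Fin n → H) (i : Fin n) : H →L[ℂ] H :=
  InnerProductSpace.rankOne ℂ (w i) (w i)

theorem linearIndependent_scaledState {p : Fin n → ℝ} {ψ : Fin n → H} (hp : ∀ i, 0 < p i)
    (hψ : LinearIndependent ℂ ψ) : LinearIndependent ℂ (scaledState p ψ) := by
  have h : ∀ i, ((√(p i) : ℝ) : ℂ) ≠ 0 := fun i => by
    exact_mod_cast (Real.sqrt_pos.2 (hp i)).ne'
  exact hψ.units_smul fun i => Units.mk0 _ (h i)

/-- `dualState` is the family biorthogonal to the subnormalized states. -/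
theorem inner_scaledState_dualState {p : Fin n → ℝ} {ψ : Fin n → H} (hp : ∀ i, 0 < p i)
    (hψ : LinearIndependent ℂ ψ) (i k : Fin n) :
    ⟪scaledState p ψ i, dualState p ψ k⟫_ℂ = if i = k then 1 else 0 := by
  have hG : (gramMatrix p ψ).PosDef :=
    Matrix.posDef_gram_of_linearIndependent (linearIndependent_scaledState hp hψ)
  have h : gramMatrix p ψ * (gramMatrix p ψ)⁻¹ = 1 :=
    Matrix.mul_nonsing_inv _ ((Matrix.isUnit_iff_isUnit_det _).1 hG.isUnit)
  have h' := congrFun (congrFun h i) k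
  rw [Matrix.one_apply, Matrix.mul_apply] at h'
  rw [← h', dualState, inner_sum]
  refine Finset.sum_congr rfl fun j _ => ?_
  rw [inner_smul_right, mul_comm]
  rfl

end

end MED

/-!
Write `φ i` for the subnormalized states. A POVM `E` is optimal as soon as its Lagrange operator
`K = ∑ i, E i |φ i⟩⟨φ i|` dominates every `|φ i⟩⟨φ i|`, because the gap to any other POVM `F` is
`∑ i, tr ((K - |φ i⟩⟨φ i|) F i) ≥ 0`; in case of equality each `(K - |φ i⟩⟨φ i|) F i` vanishes.
For the measurement in an orthonormal basis `w` with `⟨φ i|w i⟩ ≠ 0`, positivity of `K` already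
implies this domination, and `K` is injective, so the equality case determines `F`.

The equation `X² = D G D` says that `w` is orthonormal; then `X` is the matrix of `K` in the
basis `w`. Hence positive definite solutions correspond to bases with `K ≥ 0` and positive
overlaps `⟨φ i|w i⟩`. Such a basis is obtained by maximizing `∑ i, |⟨φ i|w i⟩|²` over orthonormal
families: varying `w` along the unitaries `1 + (z - 1) |v⟩⟨v|` gives `⟨v|K|v⟩ ≥ 0`, and if some
overlap vanished, positivity of `K` together with the exchange of two basis vectors would make a
basis vector orthogonal to all `φ i`.
-/

namespace MED

open InnerProductSpace Matrix

section PositiveOperator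

variable {𝕜 E : Type*} [RCLike 𝕜] [NormedAddCommGroup E] [InnerProductSpace 𝕜 E]

theorem eq_of_rankOne_self_eq_rankOne_self {u v x : E}
    (h : rankOne 𝕜 u u = rankOne 𝕜 v v) (hu : 0 < ⟪x, u⟫_𝕜) (hv : 0 < ⟪x, v⟫_𝕜) : u = v := by
  have hcomm {y : E} (hy : 0 < ⟪x, y⟫_𝕜) : ⟪y, x⟫_𝕜 = ⟪x, y⟫_𝕜 := by
    rw [← inner_conj_symm, RCLike.conj_eq_iff_im]
    exact (RCLike.pos_iff.1 hy).2
  have happ : ⟪x, u⟫_𝕜 • u = ⟪x, v⟫_𝕜 • v := by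
    simpa only [rankOne_apply, hcomm hu, hcomm hv] using congrArg (fun T : E →L[𝕜] E => T x) h
  have hsq : ⟪x, u⟫_𝕜 * ⟪x, u⟫_𝕜 = ⟪x, v⟫_𝕜 * ⟪x, v⟫_𝕜 := by
    simpa only [inner_smul_right] using congrArg (fun y => ⟪x, y⟫_𝕜) happ
  have hinner : ⟪x, u⟫_𝕜 = ⟪x, v⟫_𝕜 :=
    (mul_self_eq_mul_self_iff.1 hsq).resolve_right
      ((neg_neg_of_pos hv).trans hu).ne'
  rw [hinner] at happ
  exact smul_right_injective E hv.ne' happ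

theorem eq_zero_of_forall_inner_eq_zero_of_span_eq_top {ι : Type*} {φ : ι → E}
    (hφ : Submodule.span 𝕜 (Set.range φ) = ⊤) {x : E} (hx : ∀ i, ⟪φ i, x⟫_𝕜 = 0) : x = 0 := by
  have hle : Submodule.span 𝕜 (Set.range φ) ≤ (𝕜 ∙ x)ᗮ :=
    Submodule.span_le.2 (Set.range_subset_iff.2 fun i =>
      Submodule.mem_orthogonal_singleton_iff_inner_left.2 (hx i))
  rwa [hφ, top_le_iff, Submodule.orthogonal_eq_top_iff, Submodule.span_singleton_eq_bot] at hle

variable [FiniteDimensional 𝕜 E]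

theorem trace_comp_sum_rankOne {ι : Type*} [Fintype ι] (S : E →L[𝕜] E) (u v : ι → E) :
    LinearMap.trace 𝕜 E (S ∘L ∑ i, rankOne 𝕜 (u i) (v i) : E →L[𝕜] E) = ∑ i, ⟪v i, S (u i)⟫_𝕜 := by
  simp [ContinuousLinearMap.comp_finsetSum, comp_rankOne, trace_rankOne]

theorem trace_rankOne_comp (S : E →L[𝕜] E) (x y : E) :
    LinearMap.trace 𝕜 E (rankOne 𝕜 x y ∘L S : E →L[𝕜] E) = ⟪y, S x⟫_𝕜 := by
  rw [ContinuousLinearMap.toLinearMap_comp, LinearMap.trace_comp_comm',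
    ← ContinuousLinearMap.toLinearMap_comp, comp_rankOne, trace_rankOne]

theorem apply_eq_zero_of_inner_apply_self_eq_zero {T : E →L[𝕜] E} (hT : T.IsPositive) {x : E}
    (hx : ⟪x, T x⟫_𝕜 = 0) : T x = 0 := by
  obtain ⟨m, u, rfl⟩ := ContinuousLinearMap.isPositive_iff_eq_sum_rankOne.1 hT
  have hsum : ∑ i, ⟪x, u i⟫_𝕜 * ⟪u i, x⟫_𝕜 = 0 := by
    simpa [inner_sum, inner_smul_right, mul_comm] using hx
  have hnonneg : ∀ i ∈ Finset.univ, 0 ≤ ⟪x, u i⟫_𝕜 * ⟪u i, x⟫_𝕜 := fun i _ => by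
    rw [← inner_conj_symm]
    exact star_mul_self_nonneg _
  rw [Finset.sum_eq_zero_iff_of_nonneg hnonneg] at hsum
  have hu : ∀ i, ⟪u i, x⟫_𝕜 = 0 := fun i => by
    simpa [inner_eq_zero_symm (x := x)] using hsum i (Finset.mem_univ i)
  simp [hu]

theorem trace_comp_nonneg {S T : E →L[𝕜] E} (hS : S.IsPositive) (hT : T.IsPositive) :
    0 ≤ LinearMap.trace 𝕜 E (S ∘L T : E →L[𝕜] E) := by
  obtain ⟨m, u, rfl⟩ := ContinuousLinearMap.isPositive_iff_eq_sum_rankOne.1 hT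
  rw [trace_comp_sum_rankOne]
  exact Finset.sum_nonneg fun i _ => hS.inner_nonneg_right (u i)

theorem comp_eq_zero_of_trace_comp_eq_zero {S T : E →L[𝕜] E} (hS : S.IsPositive)
    (hT : T.IsPositive) (h : LinearMap.trace 𝕜 E (S ∘L T : E →L[𝕜] E) = 0) : S ∘L T = 0 := by
  obtain ⟨m, u, rfl⟩ := ContinuousLinearMap.isPositive_iff_eq_sum_rankOne.1 hT
  rw [trace_comp_sum_rankOne,
    Finset.sum_eq_zero_iff_of_nonneg fun i _ => hS.inner_nonneg_right (u i)] at h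
  have hu : ∀ i, S (u i) = 0 := fun i =>
    apply_eq_zero_of_inner_apply_self_eq_zero hS (h i (Finset.mem_univ i))
  simp [ContinuousLinearMap.comp_finsetSum, comp_rankOne, hu]

theorem isPositive_sub_rankOne_apply {T : E →L[𝕜] E} (hT : T.IsPositive) {v : E}
    (hv : ⟪v, T v⟫_𝕜 = 1) : (T - rankOne 𝕜 (T v) (T v)).IsPositive := by
  have := FiniteDimensional.complete 𝕜 E
  -- `Q` projects onto the `T`-orthogonal complement of `v`.
  set Q : E →L[𝕜] E := 1 - rankOne 𝕜 v (T v) with hQ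
  have hadj : Q.adjoint = 1 - rankOne 𝕜 (T v) v := by
    simp [hQ, ← ContinuousLinearMap.star_eq_adjoint (1 : E →L[𝕜] E)]
  have hconj : Q.adjoint ∘L T ∘L Q = T - rankOne 𝕜 (T v) (T v) := by
    rw [hadj]
    ext x
    simp [hQ, hv, ← hT.inner_left_eq_inner_right]
  exact hconj ▸ hT.adjoint_conj Q

end PositiveOperator

section Povm

variable {n : ℕ} {H : Type*} [NormedAddCommGroup H] [InnerProductSpace ℂ H]

/-- Holevo's Lagrange operator `∑ i, E i |φ i⟩⟨φ i|` of a measurement `E` of the subnormalized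
states `φ`: the multiplier of the constraint `∑ i, E i = 1`, with trace the success probability. -/
noncomputable def lagrangeOperator (φ : Fin n → H) (E : Fin n → H →L[ℂ] H) : H →L[ℂ] H :=
  ∑ i, rankOne ℂ (E i (φ i)) (φ i)

theorem isPOVM_rankOneFamily (b : OrthonormalBasis (Fin n) ℂ H) : IsPOVM (rankOneFamily b) where
  isPositive i := isPositive_rankOne_self (b i)
  sum_eq_one := b.sum_rankOne_eq_id

theorem eq_rankOneFamily_of_forall_mem_span {w : Fin n → H} (hw : Orthonormal ℂ w)
    {F : Fin n → H →L[ℂ] H} (hsum : ∑ i, F i = 1) (hF : ∀ i x, F i x ∈ ℂ ∙ w i) :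
    F = rankOneFamily w := by
  funext i
  ext x
  choose c hc using fun j => Submodule.mem_span_singleton.1 (hF j x)
  have hx : ∑ j, c j • w j = x := by
    simpa [hc] using congrArg (fun T : H →L[ℂ] H => T x) hsum
  rw [rankOneFamily, rankOne_apply, ← hc, ← hx, hw.inner_right_fintype]

variable [FiniteDimensional ℂ H] {φ : Fin n → H} {E F : Fin n → H →L[ℂ] H} {K : H →L[ℂ] H}

theorem trace_lagrangeOperator (φ : Fin n → H) (E : Fin n → H →L[ℂ] H) :
    LinearMap.trace ℂ H (lagrangeOperator φ E) = ∑ i, ⟪φ i, E i (φ i)⟫_ℂ := by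
  simp [lagrangeOperator, trace_rankOne]

theorem trace_sub_trace_lagrangeOperator (hsum : ∑ i, F i = 1) :
    LinearMap.trace ℂ H K - LinearMap.trace ℂ H (lagrangeOperator φ F) =
      ∑ i, LinearMap.trace ℂ H ((K - rankOne ℂ (φ i) (φ i)) ∘L F i : H →L[ℂ] H) := by
  have hK : LinearMap.trace ℂ H K = ∑ i, LinearMap.trace ℂ H (K ∘L F i : H →L[ℂ] H) := by
    rw [← map_sum, ← ContinuousLinearMap.toLinearMap_sum, ← ContinuousLinearMap.comp_finsetSum,
      hsum, ContinuousLinearMap.one_def, ContinuousLinearMap.comp_id]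
  simp only [hK, trace_lagrangeOperator, ContinuousLinearMap.sub_comp,
    ContinuousLinearMap.toLinearMap_sub, map_sub, Finset.sum_sub_distrib, trace_rankOne_comp]

theorem IsPOVM.trace_lagrangeOperator_le (hF : IsPOVM F)
    (hK : ∀ i, (K - rankOne ℂ (φ i) (φ i)).IsPositive) :
    LinearMap.trace ℂ H (lagrangeOperator φ F) ≤ LinearMap.trace ℂ H K := by
  rw [← sub_nonneg, trace_sub_trace_lagrangeOperator hF.sum_eq_one]
  exact Finset.sum_nonneg fun i _ => trace_comp_nonneg (hK i) (hF.isPositive i)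

theorem IsPOVM.sub_rankOne_comp_eq_zero (hF : IsPOVM F)
    (hK : ∀ i, (K - rankOne ℂ (φ i) (φ i)).IsPositive)
    (htr : LinearMap.trace ℂ H (lagrangeOperator φ F) = LinearMap.trace ℂ H K) (i : Fin n) :
    (K - rankOne ℂ (φ i) (φ i)) ∘L F i = 0 := by
  rw [eq_comm, ← sub_eq_zero, trace_sub_trace_lagrangeOperator hF.sum_eq_one,
    Finset.sum_eq_zero_iff_of_nonneg
      fun i _ => trace_comp_nonneg (hK i) (hF.isPositive i)] at htr
  exact comp_eq_zero_of_trace_comp_eq_zero (hK i) (hF.isPositive i) (htr i (Finset.mem_univ i))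

variable {p : Fin n → ℝ} {ψ : Fin n → H}

theorem successProb_eq_re_trace (hp : ∀ i, 0 ≤ p i) (ψ : Fin n → H) (E : Fin n → H →L[ℂ] H) :
    successProb p ψ E = (LinearMap.trace ℂ H (lagrangeOperator (scaledState p ψ) E)).re := by
  rw [trace_lagrangeOperator, Complex.re_sum]
  refine Finset.sum_congr rfl fun i _ => ?_
  rw [scaledState, map_smul, inner_smul_left, inner_smul_right, ← mul_assoc, Complex.conj_ofReal,
    ← Complex.ofReal_mul, Real.mul_self_sqrt (hp i), Complex.re_ofReal_mul]

theorem IsPOVM.isOptimalPOVM (hp : ∀ i, 0 ≤ p i) (hE : IsPOVM E)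
    (hK : ∀ i, (lagrangeOperator (scaledState p ψ) E -
      rankOne ℂ (scaledState p ψ i) (scaledState p ψ i)).IsPositive) :
    IsOptimalPOVM p ψ E := by
  refine ⟨hE, fun F hF => ?_⟩
  simp only [successProb_eq_re_trace hp]
  exact (Complex.le_def.1 (hF.trace_lagrangeOperator_le hK)).1

theorem IsOptimalPOVM.sub_rankOne_comp_eq_zero (hp : ∀ i, 0 ≤ p i) (hE : IsPOVM E)
    (hK : ∀ i, (lagrangeOperator (scaledState p ψ) E -
      rankOne ℂ (scaledState p ψ i) (scaledState p ψ i)).IsPositive)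
    (hF : IsOptimalPOVM p ψ F) (i : Fin n) :
    (lagrangeOperator (scaledState p ψ) E -
      rankOne ℂ (scaledState p ψ i) (scaledState p ψ i)) ∘L F i = 0 := by
  have hle := Complex.le_def.1 (hF.1.trace_lagrangeOperator_le hK)
  have hge := hF.2 E hE
  simp only [successProb_eq_re_trace hp] at hge
  exact hF.1.sub_rankOne_comp_eq_zero hK (Complex.ext (hle.1.antisymm hge) hle.2) i

end Povm

section RankOneFamily

variable {n : ℕ} {H : Type*} [NormedAddCommGroup H] [InnerProductSpace ℂ H] {φ w : Fin n → H}

theorem inner_lagrangeOperator_rankOneFamily (φ w : Fin n → H) (x y : H) :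
    ⟪x, lagrangeOperator φ (rankOneFamily w) y⟫_ℂ =
      ∑ i, ⟪w i, φ i⟫_ℂ * ⟪φ i, y⟫_ℂ * ⟪x, w i⟫_ℂ := by
  simp [lagrangeOperator, rankOneFamily, mul_assoc]

theorem inner_lagrangeOperator_rankOneFamily_self (hw : Orthonormal ℂ w) (i : Fin n) (y : H) :
    ⟪w i, lagrangeOperator φ (rankOneFamily w) y⟫_ℂ = ⟪w i, φ i⟫_ℂ * ⟪φ i, y⟫_ℂ := by
  simp [inner_lagrangeOperator_rankOneFamily, orthonormal_iff_ite.1 hw]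

theorem lagrangeOperator_rankOneFamily_apply_self (hw : Orthonormal ℂ w)
    (hK : (lagrangeOperator φ (rankOneFamily w)).IsPositive) (i : Fin n) :
    lagrangeOperator φ (rankOneFamily w) (w i) = ⟪φ i, w i⟫_ℂ • φ i := by
  refine ext_inner_left ℂ fun x => ?_
  rw [← hK.inner_left_eq_inner_right, ← inner_conj_symm,
    inner_lagrangeOperator_rankOneFamily_self hw, map_mul, inner_conj_symm, inner_conj_symm,
    inner_smul_right]

theorem injective_lagrangeOperator_rankOneFamily (hw : Orthonormal ℂ w)
    (hφ : Submodule.span ℂ (Set.range φ) = ⊤) (hφw : ∀ i, ⟪φ i, w i⟫_ℂ ≠ 0) :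
    Function.Injective (lagrangeOperator φ (rankOneFamily w)) := by
  refine (injective_iff_map_eq_zero _).2 fun x hx =>
    eq_zero_of_forall_inner_eq_zero_of_span_eq_top hφ fun i => ?_
  have h : ⟪w i, φ i⟫_ℂ * ⟪φ i, x⟫_ℂ = 0 := by
    rw [← inner_lagrangeOperator_rankOneFamily_self hw, hx, inner_zero_right]
  exact (mul_eq_zero.1 h).resolve_left (mt inner_eq_zero_symm.1 (hφw i))

end RankOneFamily

section OptimalBasis

variable {n : ℕ} {H : Type*} [NormedAddCommGroup H] [InnerProductSpace ℂ H]
  [FiniteDimensional ℂ H]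

theorem isPositive_lagrangeOperator_sub_rankOne {φ w : Fin n → H} (hw : Orthonormal ℂ w)
    (hK : (lagrangeOperator φ (rankOneFamily w)).IsPositive) {i : Fin n} (hi : ⟪φ i, w i⟫_ℂ ≠ 0) :
    (lagrangeOperator φ (rankOneFamily w) - rankOne ℂ (φ i) (φ i)).IsPositive := by
  set v := (⟪φ i, w i⟫_ℂ)⁻¹ • w i with hv
  have hKv : lagrangeOperator φ (rankOneFamily w) v = φ i := by
    rw [hv, map_smul, lagrangeOperator_rankOneFamily_apply_self hw hK, inv_smul_smul₀ hi]
  have hvφ : ⟪v, φ i⟫_ℂ = 1 := by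
    rw [hv, inner_smul_left, map_inv₀, inner_conj_symm,
      inv_mul_cancel₀ (mt inner_eq_zero_symm.1 hi)]
  simpa only [hKv] using isPositive_sub_rankOne_apply hK (v := v) (by rw [hKv, hvφ])

variable {p : Fin n → ℝ} {ψ : Fin n → H} {b : OrthonormalBasis (Fin n) ℂ H}

theorem isOptimalPOVM_rankOneFamily (hp : ∀ i, 0 ≤ p i)
    (hK : (lagrangeOperator (scaledState p ψ) (rankOneFamily b)).IsPositive)
    (hb : ∀ i, ⟪scaledState p ψ i, b i⟫_ℂ ≠ 0) : IsOptimalPOVM p ψ (rankOneFamily b) :=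
  (isPOVM_rankOneFamily b).isOptimalPOVM hp fun i =>
    isPositive_lagrangeOperator_sub_rankOne b.orthonormal hK (hb i)

theorem IsOptimalPOVM.eq_rankOneFamily {F : Fin n → H →L[ℂ] H} (hF : IsOptimalPOVM p ψ F)
    (hp : ∀ i, 0 ≤ p i) (hφ : Submodule.span ℂ (Set.range (scaledState p ψ)) = ⊤)
    (hK : (lagrangeOperator (scaledState p ψ) (rankOneFamily b)).IsPositive)
    (hb : ∀ i, ⟪scaledState p ψ i, b i⟫_ℂ ≠ 0) : F = rankOneFamily b := by
  set φ := scaledState p ψ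
  set K := lagrangeOperator φ (rankOneFamily b)
  refine eq_rankOneFamily_of_forall_mem_span b.orthonormal hF.1.sum_eq_one fun i x => ?_
  have hcomp : (K - rankOne ℂ (φ i) (φ i)) ∘L F i = 0 :=
    hF.sub_rankOne_comp_eq_zero hp (isPOVM_rankOneFamily b)
      (fun j => isPositive_lagrangeOperator_sub_rankOne b.orthonormal hK (hb j)) i
  have hKF : K (F i x) = ⟪φ i, F i x⟫_ℂ • φ i :=
    sub_eq_zero.1 (congrArg (fun T : H →L[ℂ] H => T x) hcomp)
  have hKb : K ((⟪φ i, F i x⟫_ℂ * (⟪φ i, b i⟫_ℂ)⁻¹) • b i) = ⟪φ i, F i x⟫_ℂ • φ i := by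
    rw [map_smul, lagrangeOperator_rankOneFamily_apply_self b.orthonormal hK, mul_smul,
      inv_smul_smul₀ (hb i)]
  exact Submodule.mem_span_singleton.2
    ⟨_, injective_lagrangeOperator_rankOneFamily b.orthonormal hφ hb (hKb.trans hKF.symm)⟩

end OptimalBasis

section Gram

theorem gram_sum_smul {𝕜 E ι κ : Type*} [RCLike 𝕜] [NormedAddCommGroup E] [InnerProductSpace 𝕜 E]
    [Fintype ι] (v : ι → E) (A : Matrix ι κ 𝕜) :
    gram 𝕜 (fun k => ∑ j, A j k • v j) = Aᴴ * gram 𝕜 v * A := by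
  ext k l
  simp only [gram_apply, Matrix.mul_apply, sum_inner, inner_sum, inner_smul_left, inner_smul_right,
    conjTranspose_apply, Finset.sum_mul, Finset.mul_sum]
  refine Finset.sum_congr rfl fun i _ => Finset.sum_congr rfl fun j _ => ?_
  rw [starRingEnd_apply]
  ring

variable {n : ℕ} {H : Type*} [NormedAddCommGroup H] [InnerProductSpace ℂ H]
  {p : Fin n → ℝ} {ψ : Fin n → H} {X : Matrix (Fin n) (Fin n) ℂ}

theorem isUnit_gramMatrix (hp : ∀ i, 0 < p i) (hψ : LinearIndependent ℂ ψ) :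
    IsUnit (gramMatrix p ψ) :=
  (posDef_gram_of_linearIndependent (linearIndependent_scaledState hp hψ)).isUnit

theorem gram_dualState (hG : IsUnit (gramMatrix p ψ)) :
    gram ℂ (dualState p ψ) = (gramMatrix p ψ)⁻¹ := by
  have hherm : (gramMatrix p ψ).IsHermitian := isHermitian_gram ℂ (scaledState p ψ)
  have hdual : dualState p ψ = fun k => ∑ j, (gramMatrix p ψ)⁻¹ j k • scaledState p ψ j := rfl
  rw [hdual, gram_sum_smul, ← gramMatrix, hherm.inv,
    nonsing_inv_mul _ ((isUnit_iff_isUnit_det _).1 hG), Matrix.one_mul]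

end Gram

section Solution

variable {n : ℕ} {G X : Matrix (Fin n) (Fin n) ℂ}

theorem sqrt_diag_pos (hX : X.PosDef) (i : Fin n) : (0 : ℂ) < (√(X i i).re : ℝ) :=
  Complex.zero_lt_real.2 (Real.sqrt_pos.2 (Complex.lt_def.1 hX.diag_pos).1)

theorem sqrt_diag_mul_self (hX : X.PosSemidef) (i : Fin n) :
    ((√(X i i).re : ℝ) : ℂ) * (√(X i i).re : ℝ) = X i i := by
  have h := Complex.nonneg_iff.1 (hX.diag_nonneg (i := i))
  rw [← Complex.ofReal_mul, Real.mul_self_sqrt h.1]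
  exact Complex.ext rfl h.2

theorem isHermitian_sqrtDiag (X : Matrix (Fin n) (Fin n) ℂ) : (sqrtDiag X).IsHermitian :=
  isHermitian_diagonal_of_self_adjoint _ (by ext i; simp)

theorem isUnit_det_sqrtDiag (hX : X.PosDef) : IsUnit (sqrtDiag X).det := by
  rw [sqrtDiag, det_diagonal, isUnit_iff_ne_zero, Finset.prod_ne_zero_iff]
  exact fun i _ => (sqrt_diag_pos hX i).ne'

theorem IsPosDefSolution.mul_conjTranspose (hX : IsPosDefSolution G X) :
    ((sqrtDiag X)⁻¹ * X) * ((sqrtDiag X)⁻¹ * X)ᴴ = G := by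
  have hu := isUnit_det_sqrtDiag hX.posDef
  rw [conjTranspose_mul, hX.posDef.isHermitian, (isHermitian_sqrtDiag X).inv]
  calc (sqrtDiag X)⁻¹ * X * (X * (sqrtDiag X)⁻¹)
      = (sqrtDiag X)⁻¹ * X ^ 2 * (sqrtDiag X)⁻¹ := by rw [sq]; simp only [Matrix.mul_assoc]
    _ = ((sqrtDiag X)⁻¹ * sqrtDiag X) * G * (sqrtDiag X * (sqrtDiag X)⁻¹) := by
        rw [hX.sq_eq]; simp only [Matrix.mul_assoc]
    _ = G := by rw [nonsing_inv_mul _ hu, mul_nonsing_inv _ hu, Matrix.one_mul, Matrix.mul_one]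

theorem sqrtDiag_eq_diagonal {d : Fin n → ℂ} (hd : ∀ i, 0 ≤ d i)
    (hX : ∀ i, X i i = d i * d i) : sqrtDiag X = diagonal d := by
  refine congrArg diagonal (funext fun i => ?_)
  obtain ⟨hre, him⟩ := Complex.nonneg_iff.1 (hd i)
  have hdi : d i = ((d i).re : ℝ) := Complex.ext rfl him.symm
  rw [hX, hdi, ← Complex.ofReal_mul, Complex.ofReal_re, Real.sqrt_mul_self hre]

theorem isPosDefSolution_of_eq_diagonal_mul {W : Matrix (Fin n) (Fin n) ℂ}
    (hW : ∀ i, 0 < W i i) (hG : IsUnit G) (hX : X.PosSemidef)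
    (hXW : X = diagonal (diag W) * W) (hWW : W * Wᴴ = G) : IsPosDefSolution G X := by
  have hsqrtDiag : sqrtDiag X = diagonal (diag W) :=
    sqrtDiag_eq_diagonal (fun i => (hW i).le) fun i => by rw [hXW, diagonal_mul, diag_apply]
  have hstar : star (diag W) = diag W := funext fun i => (hW i).le.star_eq
  have hsq : X ^ 2 = sqrtDiag X * G * sqrtDiag X :=
    calc X ^ 2 = X * Xᴴ := by rw [hX.isHermitian, sq]
      _ = diagonal (diag W) * W * (Wᴴ * diagonal (diag W)) := by
          rw [hXW, conjTranspose_mul, diagonal_conjTranspose, hstar]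
      _ = sqrtDiag X * G * sqrtDiag X := by
          rw [hsqrtDiag, ← hWW]
          simp only [Matrix.mul_assoc]
  have hunit : IsUnit (sqrtDiag X) := by
    rw [hsqrtDiag, isUnit_diagonal, Pi.isUnit_iff]
    exact fun i => (hW i).ne'.isUnit
  refine ⟨hX.posDef_iff_isUnit.2 ?_, hsq⟩
  rw [← isUnit_pow_iff two_ne_zero, hsq]
  exact (hunit.mul hG).mul hunit

variable {H : Type*} [NormedAddCommGroup H] [InnerProductSpace ℂ H]
  {p : Fin n → ℝ} {ψ : Fin n → H}

theorem IsPosDefSolution.orthonormal_basisOf (hX : IsPosDefSolution (gramMatrix p ψ) X)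
    (hG : IsUnit (gramMatrix p ψ)) : Orthonormal ℂ (basisOf p ψ X) := by
  set A := (sqrtDiag X)⁻¹ * X
  have hgram : gram ℂ (basisOf p ψ X) = Aᴴ * (gramMatrix p ψ)⁻¹ * A := by
    rw [← gram_dualState hG, ← gram_sum_smul]
    rfl
  rw [← gram_eq_one_iff_orthonormal, hgram, mul_eq_one_comm, ← Matrix.mul_assoc,
    hX.mul_conjTranspose, mul_nonsing_inv _ ((isUnit_iff_isUnit_det _).1 hG)]

theorem sqrt_diag_mul_inner_basisOf (hp : ∀ i, 0 < p i) (hψ : LinearIndependent ℂ ψ)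
    (hX : X.PosDef) (i k : Fin n) :
    (√(X i i).re : ℝ) * ⟪scaledState p ψ i, basisOf p ψ X k⟫_ℂ = X i k := by
  have hinner : ⟪scaledState p ψ i, basisOf p ψ X k⟫_ℂ = ((sqrtDiag X)⁻¹ * X) i k := by
    simp [basisOf, inner_scaledState_dualState hp hψ]
  have hmul : (sqrtDiag X * ((sqrtDiag X)⁻¹ * X)) i k = X i k := by
    rw [mul_nonsing_inv_cancel_left _ X (isUnit_det_sqrtDiag hX)]
  rwa [sqrtDiag, diagonal_mul, ← sqrtDiag, ← hinner] at hmul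

theorem inner_basisOf_self (hp : ∀ i, 0 < p i) (hψ : LinearIndependent ℂ ψ) (hX : X.PosDef)
    (i : Fin n) : ⟪scaledState p ψ i, basisOf p ψ X i⟫_ℂ = (√(X i i).re : ℝ) :=
  mul_left_cancel₀ (sqrt_diag_pos hX i).ne' <| by
    rw [sqrt_diag_mul_inner_basisOf hp hψ hX, sqrt_diag_mul_self hX.posSemidef]

theorem inner_basisOf_self_pos (hp : ∀ i, 0 < p i) (hψ : LinearIndependent ℂ ψ) (hX : X.PosDef)
    (i : Fin n) : 0 < ⟪scaledState p ψ i, basisOf p ψ X i⟫_ℂ :=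
  inner_basisOf_self hp hψ hX i ▸ sqrt_diag_pos hX i

theorem eq_of_basisOf_eq (hp : ∀ i, 0 < p i) (hψ : LinearIndependent ℂ ψ)
    {X' : Matrix (Fin n) (Fin n) ℂ} (hX : X.PosDef) (hX' : X'.PosDef)
    (h : basisOf p ψ X = basisOf p ψ X') : X = X' := by
  ext i k
  rw [← sqrt_diag_mul_inner_basisOf hp hψ hX, ← sqrt_diag_mul_inner_basisOf hp hψ hX',
    ← inner_basisOf_self hp hψ hX, ← inner_basisOf_self hp hψ hX', h]

theorem IsPosDefSolution.inner_basisOf_lagrangeOperator (hX : IsPosDefSolution (gramMatrix p ψ) X)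
    (hp : ∀ i, 0 < p i) (hψ : LinearIndependent ℂ ψ) (i k : Fin n) :
    ⟪basisOf p ψ X i,
      lagrangeOperator (scaledState p ψ) (rankOneFamily (basisOf p ψ X)) (basisOf p ψ X k)⟫_ℂ =
      X i k := by
  rw [inner_lagrangeOperator_rankOneFamily_self
      (hX.orthonormal_basisOf (isUnit_gramMatrix hp hψ)), ← inner_conj_symm,
    inner_basisOf_self hp hψ hX.posDef, Complex.conj_ofReal,
    sqrt_diag_mul_inner_basisOf hp hψ hX.posDef]

variable [FiniteDimensional ℂ H]

theorem isPositive_iff_posSemidef_toMatrixOrthonormal (b : OrthonormalBasis (Fin n) ℂ H)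
    {T : H →L[ℂ] H} :
    T.IsPositive ↔ (LinearMap.toMatrixOrthonormal b (T : H →ₗ[ℂ] H)).PosSemidef :=
  (ContinuousLinearMap.isPositive_toLinearMap_iff _).symm.trans
    (LinearMap.posSemidef_toMatrix_iff b).symm

theorem exists_orthonormalBasis_coe_eq (hdim : Module.finrank ℂ H = n) {w : Fin n → H}
    (hw : Orthonormal ℂ w) : ∃ b : OrthonormalBasis (Fin n) ℂ H, ⇑b = w :=
  ⟨OrthonormalBasis.mk hw
    (hw.linearIndependent.span_eq_top_of_card_eq_finrank' (by simp [hdim])).ge, by simp⟩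

theorem span_range_scaledState (hdim : Module.finrank ℂ H = n) (hp : ∀ i, 0 < p i)
    (hψ : LinearIndependent ℂ ψ) : Submodule.span ℂ (Set.range (scaledState p ψ)) = ⊤ :=
  (linearIndependent_scaledState hp hψ).span_eq_top_of_card_eq_finrank' (by simp [hdim])

theorem IsPosDefSolution.isPositive_lagrangeOperator (hX : IsPosDefSolution (gramMatrix p ψ) X)
    (hdim : Module.finrank ℂ H = n) (hp : ∀ i, 0 < p i) (hψ : LinearIndependent ℂ ψ) :
    (lagrangeOperator (scaledState p ψ) (rankOneFamily (basisOf p ψ X))).IsPositive := by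
  obtain ⟨b, hb⟩ := exists_orthonormalBasis_coe_eq hdim
    (hX.orthonormal_basisOf (isUnit_gramMatrix hp hψ))
  have hmatrix : LinearMap.toMatrixOrthonormal b
      (lagrangeOperator (scaledState p ψ) (rankOneFamily (basisOf p ψ X)) : H →ₗ[ℂ] H) = X := by
    ext i k
    rw [LinearMap.toMatrixOrthonormal_apply_apply, hb]
    exact hX.inner_basisOf_lagrangeOperator hp hψ i k
  rw [isPositive_iff_posSemidef_toMatrixOrthonormal b, hmatrix]
  exact hX.posDef.posSemidef

theorem IsPosDefSolution.isOptimalPOVM (hX : IsPosDefSolution (gramMatrix p ψ) X)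
    (hdim : Module.finrank ℂ H = n) (hp : ∀ i, 0 < p i) (hψ : LinearIndependent ℂ ψ) :
    IsOptimalPOVM p ψ (rankOneFamily (basisOf p ψ X)) := by
  have hK := hX.isPositive_lagrangeOperator hdim hp hψ
  have hinner := fun i => (inner_basisOf_self_pos hp hψ hX.posDef i).ne'
  obtain ⟨b, hb⟩ := exists_orthonormalBasis_coe_eq hdim
    (hX.orthonormal_basisOf (isUnit_gramMatrix hp hψ))
  rw [← hb] at hK hinner ⊢
  exact isOptimalPOVM_rankOneFamily (fun i => (hp i).le) hK hinner

theorem IsPosDefSolution.eq_rankOneFamily (hX : IsPosDefSolution (gramMatrix p ψ) X)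
    (hdim : Module.finrank ℂ H = n) (hp : ∀ i, 0 < p i) (hψ : LinearIndependent ℂ ψ)
    {E : Fin n → H →L[ℂ] H} (hE : IsOptimalPOVM p ψ E) :
    E = rankOneFamily (basisOf p ψ X) := by
  have hK := hX.isPositive_lagrangeOperator hdim hp hψ
  have hinner := fun i => (inner_basisOf_self_pos hp hψ hX.posDef i).ne'
  obtain ⟨b, hb⟩ := exists_orthonormalBasis_coe_eq hdim
    (hX.orthonormal_basisOf (isUnit_gramMatrix hp hψ))
  rw [← hb] at hK hinner ⊢
  exact hE.eq_rankOneFamily (fun i => (hp i).le) (span_range_scaledState hdim hp hψ) hK hinner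

theorem IsPosDefSolution.unique {X' : Matrix (Fin n) (Fin n) ℂ}
    (hX : IsPosDefSolution (gramMatrix p ψ) X) (hX' : IsPosDefSolution (gramMatrix p ψ) X')
    (hdim : Module.finrank ℂ H = n) (hp : ∀ i, 0 < p i) (hψ : LinearIndependent ℂ ψ) :
    X = X' := by
  have hfamily : rankOneFamily (basisOf p ψ X) = rankOneFamily (basisOf p ψ X') :=
    hX'.eq_rankOneFamily hdim hp hψ (hX.isOptimalPOVM hdim hp hψ)
  exact eq_of_basisOf_eq hp hψ hX.posDef hX'.posDef <| funext fun i =>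
    eq_of_rankOne_self_eq_rankOne_self (congrFun hfamily i)
      (inner_basisOf_self_pos hp hψ hX.posDef i) (inner_basisOf_self_pos hp hψ hX'.posDef i)

end Solution

section MaximalOverlap

section Orthonormal

variable {𝕜 E ι : Type*} [RCLike 𝕜] [NormedAddCommGroup E] [InnerProductSpace 𝕜 E]

theorem isCompact_setOf_orthonormal [Finite ι] [FiniteDimensional 𝕜 E] :
    IsCompact {w : ι → E | Orthonormal 𝕜 w} := by
  classical
  cases nonempty_fintype ι
  have := FiniteDimensional.proper 𝕜 E
  refine Metric.isCompact_of_isClosed_isBounded ?_ ?_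
  · simp only [orthonormal_iff_ite, Set.ofPred_forall]
    exact isClosed_iInter fun i => isClosed_iInter fun j =>
      isClosed_eq (by fun_prop) continuous_const
  · refine (Metric.isBounded_closedBall (x := (0 : ι → E)) (r := 1)).subset fun w hw => ?_
    rw [mem_closedBall_zero_iff, pi_norm_le_iff_of_nonneg zero_le_one]
    exact fun i => (hw.1 i).le

theorem orthonormal_smul_of_norm_eq_one {w : ι → E} (hw : Orthonormal 𝕜 w) {c : ι → 𝕜}
    (hc : ∀ i, ‖c i‖ = 1) : Orthonormal 𝕜 fun i => c i • w i :=
  ⟨fun i => by rw [norm_smul, hc, hw.1, one_mul], fun i j hij => by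
    simp only [inner_smul_left, inner_smul_right, hw.2 hij, mul_zero]⟩

-- The map `1 + (z - 1) |v⟩⟨v|` is unitary.
theorem orthonormal_add_phase_smul {w : ι → E} (hw : Orthonormal 𝕜 w) {v : E} (hv : ‖v‖ = 1)
    {z : 𝕜} (hz : ‖z‖ = 1) : Orthonormal 𝕜 fun i => w i + ((z - 1) * ⟪v, w i⟫_𝕜) • v := by
  classical
  have hvv : ⟪v, v⟫_𝕜 = 1 := inner_self_eq_one_of_norm_eq_one hv
  have hzz : (starRingEnd 𝕜) z * z = 1 := by rw [RCLike.conj_mul, hz]; simp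
  rw [orthonormal_iff_ite] at hw ⊢
  intro i j
  rw [← hw i j]
  simp only [inner_add_left, inner_add_right, inner_smul_left, inner_smul_right, hvv, map_mul,
    map_sub, map_one, inner_conj_symm]
  linear_combination ⟪w i, v⟫_𝕜 * ⟪v, w j⟫_𝕜 * hzz

end Orthonormal

theorem nonneg_of_forall_re_sub_one_mul_nonpos {t : ℂ}
    (h : ∀ z : ℂ, ‖z‖ = 1 → ((z - 1) * t).re ≤ 0) : 0 ≤ t := by
  obtain ⟨c, hc, hct⟩ := Complex.exists_norm_mul_eq_self t
  have hconj : (starRingEnd ℂ) c * t = ‖t‖ := by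
    conv_lhs => rw [← hct]
    rw [← mul_assoc, Complex.conj_mul', hc, Complex.ofReal_one, one_pow, one_mul]
  have hre := h ((starRingEnd ℂ) c) (by rw [RCLike.norm_conj, hc])
  rw [sub_mul, hconj, one_mul, Complex.sub_re, Complex.ofReal_re, sub_nonpos] at hre
  exact Complex.re_eq_norm.1 ((Complex.re_le_norm t).antisymm hre)

variable {H : Type*} [NormedAddCommGroup H] [InnerProductSpace ℂ H]

theorem isPositive_of_forall_norm_eq_one {T : H →L[ℂ] H}
    (h : ∀ v, ‖v‖ = 1 → 0 ≤ ⟪v, T v⟫_ℂ) : T.IsPositive := by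
  have hT : ∀ x, 0 ≤ ⟪T x, x⟫_ℂ := fun x => by
    rcases eq_or_ne x 0 with rfl | hx
    · simp
    obtain ⟨v, hv, hxv⟩ : ∃ v : H, ‖v‖ = 1 ∧ x = (‖x‖ : ℂ) • v :=
      ⟨(‖x‖⁻¹ : ℂ) • x, norm_smul_inv_norm hx, by
        rw [smul_inv_smul₀ (Complex.ofReal_ne_zero.2 (norm_ne_zero_iff.2 hx))]⟩
    have hvT : 0 ≤ ⟪T v, v⟫_ℂ := by
      rw [← inner_conj_symm]
      exact star_nonneg_iff.2 (h v hv)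
    rw [hxv, map_smul, inner_smul_left, inner_smul_right, ← mul_assoc]
    exact mul_nonneg (star_mul_self_nonneg _) hvT
  rw [ContinuousLinearMap.isPositive_iff_complex]
  intro x
  obtain ⟨hre, him⟩ := Complex.nonneg_iff.1 (hT x)
  exact ⟨Complex.ext rfl him, hre⟩

section TotalOverlap

variable {ι : Type*} [Fintype ι] {φ v w : ι → H}

/-- The squared overlap `∑ i, |⟨φ i|w i⟩|²` of two families. For subnormalized states `φ` and an
orthonormal basis `w`, it is the success probability of the measurement in the basis `w`. -/
noncomputable def totalOverlap (φ w : ι → H) : ℝ :=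
  ∑ i, ‖⟪φ i, w i⟫_ℂ‖ ^ 2

theorem exists_isMaxOn_totalOverlap [FiniteDimensional ℂ H]
    (hdim : Module.finrank ℂ H = Fintype.card ι) (φ : ι → H) :
    ∃ w, Orthonormal ℂ w ∧ IsMaxOn (totalOverlap φ) {v | Orthonormal ℂ v} w ∧
      ∀ i, 0 ≤ ⟪φ i, w i⟫_ℂ := by
  obtain ⟨u, hu, hmax⟩ := (isCompact_setOf_orthonormal (𝕜 := ℂ) (ι := ι) (E := H)).exists_isMaxOn
    ⟨(stdOrthonormalBasis ℂ H).reindex (Fintype.equivFinOfCardEq hdim.symm).symm,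
      OrthonormalBasis.orthonormal _⟩
    (f := totalOverlap φ) (by unfold totalOverlap; fun_prop)
  choose c hc hcu using fun i => Complex.exists_norm_mul_eq_self ⟪φ i, u i⟫_ℂ
  have hphase : ∀ i, ⟪φ i, (starRingEnd ℂ) (c i) • u i⟫_ℂ = ‖⟪φ i, u i⟫_ℂ‖ := fun i => by
    conv_lhs => rw [inner_smul_right, ← hcu i]
    rw [← mul_assoc, Complex.conj_mul', hc, Complex.ofReal_one, one_pow, one_mul]
  refine ⟨fun i => (starRingEnd ℂ) (c i) • u i,
    orthonormal_smul_of_norm_eq_one hu fun i => by rw [RCLike.norm_conj, hc], ?_,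
    fun i => by rw [hphase]; exact Complex.zero_le_real.2 (norm_nonneg _)⟩
  have heq : totalOverlap φ (fun i => (starRingEnd ℂ) (c i) • u i) = totalOverlap φ u := by
    simp only [totalOverlap, hphase, Complex.norm_real, norm_norm]
  exact fun v hv => (hmax hv).trans_eq heq.symm

theorem re_sum_inner_mul_inner_le (h : totalOverlap φ v ≤ totalOverlap φ w) :
    (∑ i, ⟪w i, φ i⟫_ℂ * ⟪φ i, v i⟫_ℂ).re ≤ totalOverlap φ w := by
  have hterm : ∀ i, (⟪w i, φ i⟫_ℂ * ⟪φ i, v i⟫_ℂ).re ≤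
      (‖⟪φ i, w i⟫_ℂ‖ ^ 2 + ‖⟪φ i, v i⟫_ℂ‖ ^ 2) / 2 := fun i => by
    have hnorm := Complex.re_le_norm (⟪w i, φ i⟫_ℂ * ⟪φ i, v i⟫_ℂ)
    rw [norm_mul, norm_inner_symm] at hnorm
    linarith [two_mul_le_add_sq ‖⟪φ i, w i⟫_ℂ‖ ‖⟪φ i, v i⟫_ℂ‖]
  calc (∑ i, ⟪w i, φ i⟫_ℂ * ⟪φ i, v i⟫_ℂ).re
      ≤ ∑ i, (‖⟪φ i, w i⟫_ℂ‖ ^ 2 + ‖⟪φ i, v i⟫_ℂ‖ ^ 2) / 2 := by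
        rw [Complex.re_sum]
        exact Finset.sum_le_sum fun i _ => hterm i
    _ = (totalOverlap φ w + totalOverlap φ v) / 2 := by
        rw [← Finset.sum_div, Finset.sum_add_distrib, totalOverlap, totalOverlap]
    _ ≤ totalOverlap φ w := by linarith

theorem inner_eq_zero_of_isMaxOn_totalOverlap (hw : Orthonormal ℂ w)
    (hmax : IsMaxOn (totalOverlap φ) {v | Orthonormal ℂ v} w) {i s : ι}
    (hi : ⟪φ i, w i⟫_ℂ = 0) (hs : ⟪φ s, w s⟫_ℂ = 0) : ⟪φ i, w s⟫_ℂ = 0 := by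
  classical
  have hle : ∀ j ∈ Finset.univ,
      ‖⟪φ j, w j⟫_ℂ‖ ^ 2 ≤ ‖⟪φ j, (w ∘ Equiv.swap i s) j⟫_ℂ‖ ^ 2 := fun j _ => by
    rcases eq_or_ne j i with rfl | hji
    · rw [hi, norm_zero, zero_pow two_ne_zero]
      positivity
    rcases eq_or_ne j s with rfl | hjs
    · rw [hs, norm_zero, zero_pow two_ne_zero]
      positivity
    rw [Function.comp_apply, Equiv.swap_apply_of_ne_of_ne hji hjs]
  have hswap : totalOverlap φ (w ∘ Equiv.swap i s) ≤ totalOverlap φ w :=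
    hmax (hw.comp _ (Equiv.injective _))
  have heq := (Finset.sum_eq_sum_iff_of_le hle).1 ((Finset.sum_le_sum hle).antisymm hswap) i
    (Finset.mem_univ i)
  rw [Function.comp_apply, Equiv.swap_apply_left, hi, norm_zero, zero_pow two_ne_zero] at heq
  exact norm_eq_zero.1 (pow_eq_zero_iff two_ne_zero |>.1 heq.symm)

end TotalOverlap

variable {n : ℕ} {φ w : Fin n → H}

theorem isPositive_lagrangeOperator_of_isMaxOn (hw : Orthonormal ℂ w)
    (hmax : IsMaxOn (totalOverlap φ) {v | Orthonormal ℂ v} w) :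
    (lagrangeOperator φ (rankOneFamily w)).IsPositive := by
  refine isPositive_of_forall_norm_eq_one fun v hv =>
    nonneg_of_forall_re_sub_one_mul_nonpos fun z hz => ?_
  have hexpand : ∑ i, ⟪w i, φ i⟫_ℂ * ⟪φ i, w i + ((z - 1) * ⟪v, w i⟫_ℂ) • v⟫_ℂ =
      totalOverlap φ w + (z - 1) * ⟪v, lagrangeOperator φ (rankOneFamily w) v⟫_ℂ := by
    rw [inner_lagrangeOperator_rankOneFamily, totalOverlap, Finset.mul_sum, Complex.ofReal_sum,
      ← Finset.sum_add_distrib]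
    refine Finset.sum_congr rfl fun i _ => ?_
    rw [inner_add_right, inner_smul_right, Complex.ofReal_pow, ← Complex.conj_mul',
      inner_conj_symm]
    ring
  have hle := re_sum_inner_mul_inner_le (hmax (orthonormal_add_phase_smul hw hv hz))
  rwa [hexpand, Complex.add_re, Complex.ofReal_re, add_le_iff_nonpos_right] at hle

theorem inner_ne_zero_of_isMaxOn_totalOverlap (hφ : Submodule.span ℂ (Set.range φ) = ⊤)
    (hw : Orthonormal ℂ w) (hmax : IsMaxOn (totalOverlap φ) {v | Orthonormal ℂ v} w)
    (s : Fin n) : ⟪φ s, w s⟫_ℂ ≠ 0 := by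
  intro hs
  have hK : lagrangeOperator φ (rankOneFamily w) (w s) = 0 := by
    rw [lagrangeOperator_rankOneFamily_apply_self hw
      (isPositive_lagrangeOperator_of_isMaxOn hw hmax), hs, zero_smul]
  refine hw.ne_zero s (eq_zero_of_forall_inner_eq_zero_of_span_eq_top hφ fun i => ?_)
  by_cases hi : ⟪φ i, w i⟫_ℂ = 0
  · exact inner_eq_zero_of_isMaxOn_totalOverlap hw hmax hi hs
  · have hzero := inner_lagrangeOperator_rankOneFamily_self (φ := φ) hw i (w s)
    rw [hK, inner_zero_right, eq_comm, mul_eq_zero] at hzero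
    exact hzero.resolve_left (mt inner_eq_zero_symm.1 hi)

end MaximalOverlap

section Existence

variable {n : ℕ} {H : Type*} [NormedAddCommGroup H] [InnerProductSpace ℂ H]
  [FiniteDimensional ℂ H]

theorem isPosDefSolution_toMatrixOrthonormal {φ : Fin n → H} (hφ : LinearIndependent ℂ φ)
    {b : OrthonormalBasis (Fin n) ℂ H} (hb : ∀ i, 0 < ⟪φ i, b i⟫_ℂ)
    (hK : (lagrangeOperator φ (rankOneFamily b)).IsPositive) :
    IsPosDefSolution (gram ℂ φ) (LinearMap.toMatrixOrthonormal b
      (lagrangeOperator φ (rankOneFamily b) : H →ₗ[ℂ] H)) := by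
  set W : Matrix (Fin n) (Fin n) ℂ := .of fun i k => ⟪φ i, b k⟫_ℂ with hW
  have hWW : W * Wᴴ = gram ℂ φ := by
    ext i j
    simp [hW, Matrix.mul_apply, b.sum_inner_mul_inner]
  refine isPosDefSolution_of_eq_diagonal_mul (W := W) hb
    (posDef_gram_of_linearIndependent hφ).isUnit
    ((isPositive_iff_posSemidef_toMatrixOrthonormal b).1 hK) ?_ hWW
  ext i k
  rw [diagonal_mul, LinearMap.toMatrixOrthonormal_apply_apply, ContinuousLinearMap.coe_coe,
    inner_lagrangeOperator_rankOneFamily_self b.orthonormal, ← inner_conj_symm,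
    starRingEnd_apply, (hb i).le.star_eq]
  rfl

theorem exists_isPosDefSolution (hdim : Module.finrank ℂ H = n) {φ : Fin n → H}
    (hφ : LinearIndependent ℂ φ) :
    ∃ X : Matrix (Fin n) (Fin n) ℂ, IsPosDefSolution (gram ℂ φ) X := by
  have hspan : Submodule.span ℂ (Set.range φ) = ⊤ :=
    hφ.span_eq_top_of_card_eq_finrank' (by simp [hdim])
  obtain ⟨w, hw, hmax, hnonneg⟩ := exists_isMaxOn_totalOverlap (by simp [hdim]) φ
  have hpos : ∀ i, 0 < ⟪φ i, w i⟫_ℂ := fun i =>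
    (hnonneg i).lt_of_ne' (inner_ne_zero_of_isMaxOn_totalOverlap hspan hw hmax i)
  have hK := isPositive_lagrangeOperator_of_isMaxOn hw hmax
  obtain ⟨b, rfl⟩ := exists_orthonormalBasis_coe_eq hdim hw
  exact ⟨_, isPosDefSolution_toMatrixOrthonormal hφ hpos hK⟩

end Existence

end MED

theorem theorem2_general {n : ℕ} {H : Type*} [NormedAddCommGroup H] [InnerProductSpace ℂ H]
    [FiniteDimensional ℂ H] (hdim : Module.finrank ℂ H = n)
    (p : Fin n → ℝ) (ψ : Fin n → H)
    (hp : ∀ i, 0 < p i) (hψ : LinearIndependent ℂ ψ) :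
    (∀ X : Matrix (Fin n) (Fin n) ℂ, MED.IsPosDefSolution (MED.gramMatrix p ψ) X →
      Orthonormal ℂ (MED.basisOf p ψ X) ∧
      MED.IsOptimalPOVM p ψ (MED.rankOneFamily (MED.basisOf p ψ X)) ∧
      ∀ E : Fin n → H →L[ℂ] H, MED.IsOptimalPOVM p ψ E →
        E = MED.rankOneFamily (MED.basisOf p ψ X)) ∧
    (∀ X X' : Matrix (Fin n) (Fin n) ℂ, MED.IsPosDefSolution (MED.gramMatrix p ψ) X →
      MED.IsPosDefSolution (MED.gramMatrix p ψ) X' → X = X') ∧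
    (∀ E : Fin n → H →L[ℂ] H, MED.IsOptimalPOVM p ψ E ↔
      ∃ X : Matrix (Fin n) (Fin n) ℂ, MED.IsPosDefSolution (MED.gramMatrix p ψ) X ∧
        E = MED.rankOneFamily (MED.basisOf p ψ X)) := by
  refine ⟨fun X hX => ⟨hX.orthonormal_basisOf (MED.isUnit_gramMatrix hp hψ),
      hX.isOptimalPOVM hdim hp hψ, fun E => hX.eq_rankOneFamily hdim hp hψ⟩,
    fun X X' hX hX' => hX.unique hX' hdim hp hψ, fun E => ⟨fun hE => ?_, ?_⟩⟩
  · obtain ⟨X, hX⟩ :=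
      MED.exists_isPosDefSolution hdim (MED.linearIndependent_scaledState hp hψ)
    exact ⟨X, hX, hX.eq_rankOneFamily hdim hp hψ hE⟩
  · rintro ⟨X, hX, rfl⟩
    exact hX.isOptimalPOVM hdim hp hψ

theorem theorem2 {n : ℕ} {H : Type*} [NormedAddCommGroup H] [InnerProductSpace ℂ H]
    [FiniteDimensional ℂ H] (hdim : Module.finrank ℂ H = n)
    (p : Fin n → ℝ) (ψ : Fin n → H)
    (hp : ∀ i, 0 < p i) (hp_sum : ∑ i, p i = 1)
    (hψ_norm : ∀ i, ‖ψ i‖ = 1) (hψ : LinearIndependent ℂ ψ) :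
    -- a positive definite solution yields an orthonormal basis whose projectors are the
    -- (unique) optimal POVM
    (∀ X : Matrix (Fin n) (Fin n) ℂ, MED.IsPosDefSolution (MED.gramMatrix p ψ) X →
      Orthonormal ℂ (MED.basisOf p ψ X) ∧
      MED.IsOptimalPOVM p ψ (MED.rankOneFamily (MED.basisOf p ψ X)) ∧
      ∀ E : Fin n → H →L[ℂ] H, MED.IsOptimalPOVM p ψ E →
        E = MED.rankOneFamily (MED.basisOf p ψ X)) ∧
    -- the positive definite solution is unique
    (∀ X X' : Matrix (Fin n) (Fin n) ℂ, MED.IsPosDefSolution (MED.gramMatrix p ψ) X →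
      MED.IsPosDefSolution (MED.gramMatrix p ψ) X' → X = X') ∧
    -- necessary and sufficient conditions for optimality
    (∀ E : Fin n → H →L[ℂ] H, MED.IsOptimalPOVM p ψ E ↔
      ∃ X : Matrix (Fin n) (Fin n) ℂ, MED.IsPosDefSolution (MED.gramMatrix p ψ) X ∧
        E = MED.rankOneFamily (MED.basisOf p ψ X)) :=
  theorem2_general hdim p ψ hp hψ
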